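/- For integers $n \ge k \ge 1$, the Johnson graph $J(n,k)$ is the graph whose vertices are the $k$-element subsets of $\{1,\dots,n\}$, two of them being adjacent when their intersection has exactly $k-1$ elements. A vertex-cut of a graph $G$ is a set $S$ of vertices such that $G-S$ is disconnected or has an isolated vertex; a super vertex-cut of $G$ is a vertex-cut $S$ such that $G-S$ has no isolated vertices. The super-connectivity $\kappa'(G)$ is the minimum cardinality of a super vertex-cut of $G$, with $\kappa'(G)=+\infty$ if $G$ has none. Theorem. For all integers $k\ge 3$ and $n\ge k+3$, $$\kappa'(J(n,k)) = (2k-1)(n-k)-k .$$ -/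

import Mathlib

/-- The Johnson graph `J(n,k)`: the vertices are the `k`-subsets of an `n`-set, and two of them are
adjacent when they meet in exactly `k - 1` elements. -/
def johnsonGraph (n k : ℕ) : SimpleGraph {s : Finset (Fin n) // s.card = k} where
  Adj u v := (u.1 ∩ v.1).card + 1 = k
  symm := ⟨fun u v h => by rwa [Finset.inter_comm]⟩
  loopless := ⟨fun u h => by
    have hu := u.2
    rw [Finset.inter_self] at h
    omega⟩

namespace SimpleGraph

variable {V : Type*}

/-- A vertex-cut of `G`: a set `S` of vertices such that `G - S` is disconnected (two of its vertices
are not joined by a path) or has an isolated vertex. -/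
def IsVertexCut (G : SimpleGraph V) (S : Set V) : Prop :=
  ¬ (G.induce Sᶜ).Preconnected ∨ ∃ v, (G.induce Sᶜ).IsIsolated v

/-- A super vertex-cut of `G`: a vertex-cut `S` such that `G - S` has no isolated vertices. -/
def IsSuperVertexCut (G : SimpleGraph V) (S : Set V) : Prop :=
  G.IsVertexCut S ∧ ∀ v, ¬ (G.induce Sᶜ).IsIsolated v

/-- The super-connectivity `κ'(G)`: the least size of a super vertex-cut, and `⊤` if there is
none. -/
noncomputable def superConnectivity (G : SimpleGraph V) : ℕ∞ :=
  ⨅ (S : Set V) (_ : G.IsSuperVertexCut S), S.encard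

end SimpleGraph

/-! ### Separations of Johnson graphs and their slices -/

namespace Finset

/-! Put a = k and b = n - k; the value is 2ab - a - b. Lower bound: a super vertex-cut T separates
two families A and B with at least two members each. For a ground element e, the sets containing e
and the sets avoiding e form J(n-1,k-1) and J(n-1,k), where separating costs at least (a-1)b and
a(b-1) (`mul_le_card`, by induction on the ground set). The sum is exactly 2ab - a - b, which
settles the case where some e splits both A and B. Otherwise every e is constant on A or on B, so by
pigeonhole one family, say A, is constant in the same way at two elements p, q. In the slice that B
misses, a fake family {z} far from A then replaces B (`exists_far`, `two_mul_mul_le_of_const`).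
Upper bound: an edge has at most 2ab - a - b neighbours, and by `exists_swap_far` deleting them
isolates no vertex. -/

lemma exists_mem_and_exists_notMem {α : Type*} {U : Finset α} {k : ℕ} {A : Finset (Finset α)}
    (hA : ∀ x ∈ A, x ⊆ U ∧ #x = k) (hA1 : 1 < #A) :
    ∃ e ∈ U, (∃ x ∈ A, e ∈ x) ∧ ∃ x ∈ A, e ∉ x := by
  obtain ⟨x, hx, y, hy, hxy⟩ := one_lt_card.1 hA1
  have : ¬ x ⊆ y := fun h' =>
    hxy (eq_of_subset_of_card_le h' (by rw [(hA x hx).2, (hA y hy).2]))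
  obtain ⟨e, hex, hey⟩ := not_subset.1 this
  exact ⟨e, (hA x hx).1 hex, ⟨x, hx, hex⟩, y, hy, hey⟩

variable {α : Type*} [DecidableEq α]

/-- `A` and `B` are nonempty families of `k`-subsets of `U`, no member of `A` being equal or adjacent
(in the Johnson graph) to a member of `B`, and `T` contains all the other `k`-subsets of `U`. -/
structure IsJohnsonSeparation (U : Finset α) (k : ℕ) (A B T : Finset (Finset α)) : Prop where
  left_mem : ∀ x ∈ A, x ⊆ U ∧ #x = k
  right_mem : ∀ x ∈ B, x ⊆ U ∧ #x = k
  left_nonempty : A.Nonempty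
  right_nonempty : B.Nonempty
  far : ∀ x ∈ A, ∀ y ∈ B, #(x ∩ y) + 2 ≤ k
  cover : ∀ x ⊆ U, #x = k → x ∈ A ∨ x ∈ B ∨ x ∈ T

namespace IsJohnsonSeparation

variable {U : Finset α} {k : ℕ} {A B T : Finset (Finset α)} {e : α}

lemma symm (h : IsJohnsonSeparation U k A B T) : IsJohnsonSeparation U k B A T where
  left_mem := h.right_mem
  right_mem := h.left_mem
  left_nonempty := h.right_nonempty
  right_nonempty := h.left_nonempty
  far x hx y hy := by rw [inter_comm]; exact h.far y hy x hx
  cover x hx hk := by have := h.cover x hx hk; tauto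

lemma nonMember (h : IsJohnsonSeparation U k A B T) (hA : ∃ x ∈ A, e ∉ x) (hB : ∃ x ∈ B, e ∉ x) :
    IsJohnsonSeparation (U.erase e) k (A.nonMemberSubfamily e) (B.nonMemberSubfamily e)
      (T.nonMemberSubfamily e) where
  left_mem x hx := by
    rw [mem_nonMemberSubfamily] at hx
    exact ⟨subset_erase.2 ⟨(h.left_mem x hx.1).1, hx.2⟩, (h.left_mem x hx.1).2⟩
  right_mem x hx := by
    rw [mem_nonMemberSubfamily] at hx
    exact ⟨subset_erase.2 ⟨(h.right_mem x hx.1).1, hx.2⟩, (h.right_mem x hx.1).2⟩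
  left_nonempty := hA.imp fun x hx => mem_nonMemberSubfamily.2 hx
  right_nonempty := hB.imp fun x hx => mem_nonMemberSubfamily.2 hx
  far x hx y hy := h.far x (mem_nonMemberSubfamily.1 hx).1 y (mem_nonMemberSubfamily.1 hy).1
  cover x hx hk := by
    rw [subset_erase] at hx
    simpa [hx.2] using h.cover x hx.1 hk

lemma mem_of_mem_memberSubfamily (hA : ∀ x ∈ A, x ⊆ U ∧ #x = k + 1) {x : Finset α}
    (hx : x ∈ A.memberSubfamily e) : x ⊆ U.erase e ∧ #x = k := by
  rw [mem_memberSubfamily] at hx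
  have := hA _ hx.1
  rw [card_insert_of_notMem hx.2] at this
  exact ⟨subset_erase.2 ⟨(subset_insert _ _).trans this.1, hx.2⟩, by lia⟩

lemma memberSubfamily_nonempty (hA : ∃ x ∈ A, e ∈ x) : (A.memberSubfamily e).Nonempty := by
  obtain ⟨x, hx, hex⟩ := hA
  exact ⟨x.erase e, by simp [mem_memberSubfamily, insert_erase hex, hx]⟩

/-- Removing the common element lowers both k and the intersections by one, so the gap of two
survives. -/
lemma member (h : IsJohnsonSeparation U (k + 1) A B T) (he : e ∈ U) (hA : ∃ x ∈ A, e ∈ x)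
    (hB : ∃ x ∈ B, e ∈ x) :
    IsJohnsonSeparation (U.erase e) k (A.memberSubfamily e) (B.memberSubfamily e)
      (T.memberSubfamily e) where
  left_mem x hx := mem_of_mem_memberSubfamily h.left_mem hx
  right_mem x hx := mem_of_mem_memberSubfamily h.right_mem hx
  left_nonempty := memberSubfamily_nonempty hA
  right_nonempty := memberSubfamily_nonempty hB
  far x hx y hy := by
    rw [mem_memberSubfamily] at hx hy
    have := h.far _ hx.1 _ hy.1
    rw [← insert_inter_distrib, card_insert_of_notMem (by simp [hx.2])] at this
    lia
  cover x hx hk := by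
    rw [subset_erase] at hx
    simpa [hx.2] using h.cover (insert e x) (insert_subset he hx.1)
      (by rw [card_insert_of_notMem hx.2, hk])

/-- A separation of one slice, when the whole slice of `B` is empty and `z` is a set of the slice far
from `A`. -/
lemma nonMember_of_far (h : IsJohnsonSeparation U k A B T) (hA : ∃ x ∈ A, e ∉ x)
    (hB : ∀ x ∈ B, e ∈ x) {z : Finset α} (hz : z ⊆ U.erase e) (hzk : #z = k)
    (hfar : ∀ x ∈ A.nonMemberSubfamily e, #(x ∩ z) + 2 ≤ k) :
    IsJohnsonSeparation (U.erase e) k (A.nonMemberSubfamily e) {z} (T.nonMemberSubfamily e) where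
  left_mem x hx := by
    rw [mem_nonMemberSubfamily] at hx
    exact ⟨subset_erase.2 ⟨(h.left_mem x hx.1).1, hx.2⟩, (h.left_mem x hx.1).2⟩
  right_mem x hx := by rw [mem_singleton.1 hx]; exact ⟨hz, hzk⟩
  left_nonempty := hA.imp fun x hx => mem_nonMemberSubfamily.2 hx
  right_nonempty := singleton_nonempty z
  far x hx y hy := by rw [mem_singleton.1 hy]; exact hfar x hx
  cover x hx hk := by
    rw [subset_erase] at hx
    have h1 := h.cover x hx.1 hk
    have h2 := mt (hB x) hx.2
    simp only [mem_nonMemberSubfamily]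
    tauto

lemma member_of_far (h : IsJohnsonSeparation U (k + 1) A B T) (he : e ∈ U) (hA : ∃ x ∈ A, e ∈ x)
    (hB : ∀ x ∈ B, e ∉ x) {z : Finset α} (hz : z ⊆ U.erase e) (hzk : #z = k)
    (hfar : ∀ x ∈ A.memberSubfamily e, #(x ∩ z) + 2 ≤ k) :
    IsJohnsonSeparation (U.erase e) k (A.memberSubfamily e) {z} (T.memberSubfamily e) where
  left_mem x hx := mem_of_mem_memberSubfamily h.left_mem hx
  right_mem x hx := by rw [mem_singleton.1 hx]; exact ⟨hz, hzk⟩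
  left_nonempty := memberSubfamily_nonempty hA
  right_nonempty := singleton_nonempty z
  far x hx y hy := by rw [mem_singleton.1 hy]; exact hfar x hx
  cover x hx hk := by
    rw [subset_erase] at hx
    have h1 := h.cover (insert e x) (insert_subset he hx.1) (by rw [card_insert_of_notMem hx.2, hk])
    have h2 := fun h' => hB (insert e x) h' (mem_insert_self e x)
    simp only [mem_memberSubfamily]
    tauto

/-- A `k`-set that meets a member of `B` in `k - 1` elements and is outside `B` lies in `T`. -/
lemma mem_of_near_right (h : IsJohnsonSeparation U k A B T) {x y : Finset α} (hy : y ∈ B)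
    (hxU : x ⊆ U) (hxk : #x = k) (hxy : k ≤ #(x ∩ y) + 1) (hx : x ∉ B) : x ∈ T := by
  rcases h.cover x hxU hxk with h1 | h1 | h1
  · have := h.far x h1 y hy
    lia
  · exact absurd h1 hx
  · exact h1

/-- Exchanging any element of some y in B for e gives a neighbour of y outside B, hence in T. This
is the cost of a slice that B misses. -/
lemma card_le_memberSubfamily (h : IsJohnsonSeparation U k A B T) (he : e ∈ U)
    (hB : ∀ x ∈ B, e ∉ x) : k ≤ #(T.memberSubfamily e) := by
  obtain ⟨y, hy⟩ := h.right_nonempty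
  obtain ⟨hyU, hyk⟩ := h.right_mem y hy
  have hey := hB y hy
  rw [← hyk]
  refine card_le_card_of_injOn (fun t => y.erase t) (fun t ht => ?_) (erase_injOn y)
  have het : e ∉ y.erase t := fun h' => hey (mem_of_mem_erase h')
  have hc := card_erase_add_one (mem_coe.1 ht)
  simp only [mem_coe, mem_memberSubfamily]
  refine ⟨h.mem_of_near_right hy (insert_subset he ((erase_subset _ _).trans hyU)) ?_ ?_
    fun h' => hB _ h' (mem_insert_self _ _), het⟩
  · rw [card_insert_of_notMem het]; lia
  · have : y.erase t ⊆ insert e (y.erase t) ∩ y :=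
      subset_inter (subset_insert _ _) (erase_subset _ _)
    have := card_le_card this
    lia

lemma card_le_nonMemberSubfamily (h : IsJohnsonSeparation U k A B T)
    (hB : ∀ x ∈ B, e ∈ x) : #U - k ≤ #(T.nonMemberSubfamily e) := by
  obtain ⟨y, hy⟩ := h.right_nonempty
  obtain ⟨hyU, hyk⟩ := h.right_mem y hy
  have hey := hB y hy
  have hc := card_erase_add_one hey
  rw [← hyk, ← card_sdiff_of_subset hyU]
  refine card_le_card_of_injOn (fun s => insert s (y.erase e)) (fun s hs => ?_) ?_
  · simp only [coe_sdiff, Set.mem_sdiff, mem_coe] at hs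
    have hsy : s ∉ y.erase e := fun h' => hs.2 (mem_of_mem_erase h')
    have hes : e ∉ insert s (y.erase e) := by
      have : e ≠ s := by rintro rfl; exact hs.2 hey
      simp [this]
    simp only [mem_coe, mem_nonMemberSubfamily]
    refine ⟨h.mem_of_near_right hy (insert_subset hs.1 ((erase_subset _ _).trans hyU)) ?_ ?_
      fun h' => hes (hB _ h'), hes⟩
    · rw [card_insert_of_notMem hsy]; lia
    · have : y.erase e ⊆ insert s (y.erase e) ∩ y :=
        subset_inter (subset_insert _ _) (erase_subset _ _)
      have := card_le_card this
      lia
  · intro s hs s' hs' hss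
    simp only [coe_sdiff, Set.mem_sdiff, mem_coe] at hs hs'
    exact (insert_inj fun h' => hs.2 (mem_of_mem_erase h')).1 hss

/-- The members of `T` adjacent to the only member of `B`. -/
lemma mul_le_card_of_singleton {y : Finset α} (h : IsJohnsonSeparation U k A {y} T) :
    k * (#U - k) ≤ #T := by
  obtain ⟨hyU, hyk⟩ := h.right_mem y (mem_singleton_self y)
  have hcard : k * (#U - k) = #(y ×ˢ (U \ y)) := by
    rw [card_product, card_sdiff_of_subset hyU, hyk]
  rw [hcard]
  refine card_le_card_of_injOn (fun p => insert p.2 (y.erase p.1)) ?_ ?_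
  · rintro ⟨t, s⟩ hp
    simp only [mem_coe, mem_product, mem_sdiff] at hp
    obtain ⟨ht, hsU, hsy⟩ := hp
    have hc := card_erase_add_one ht
    have hsy' : s ∉ y.erase t := fun h' => hsy (mem_of_mem_erase h')
    refine h.mem_of_near_right (mem_singleton_self y)
      (insert_subset hsU ((erase_subset _ _).trans hyU)) ?_ ?_ ?_
    · rw [card_insert_of_notMem hsy']; lia
    · have : y.erase t ⊆ insert s (y.erase t) ∩ y :=
        subset_inter (subset_insert _ _) (erase_subset _ _)
      have := card_le_card this
      lia
    · intro h'
      exact hsy (mem_singleton.1 h' ▸ mem_insert_self s (y.erase t))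
  · rintro ⟨t, s⟩ hp ⟨t', s'⟩ hp' heq
    simp only [mem_coe, mem_product, mem_sdiff] at hp hp' heq
    have hs : s = s' := by
      have : s ∈ insert s' (y.erase t') := heq ▸ mem_insert_self _ _
      rcases mem_insert.1 this with h' | h'
      · exact h'
      · exact absurd (mem_of_mem_erase h') hp.2.2
    subst hs
    have ht : t = t' := by
      by_contra hne
      have h1 : t ∈ insert s (y.erase t') := mem_insert_of_mem (mem_erase.2 ⟨hne, hp.1⟩)
      rw [← heq] at h1
      rcases mem_insert.1 h1 with h' | h'
      · exact hp.2.2 (h' ▸ hp.1)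
      · simp at h'
    rw [ht]

/-- The Johnson graph on the `a`-subsets of an `(a + b)`-set has connectivity at least `a * b`. -/
theorem mul_le_card {a b : ℕ} (h : IsJohnsonSeparation U a A B T) (hU : #U = a + b) :
    a * b ≤ #T := by
  induction hn : #U generalizing U a b A B T with
  | zero =>
    have : a = 0 := by lia
    simp [this]
  | succ n ih =>
    obtain ⟨x₀, hx₀⟩ := h.left_nonempty
    obtain ⟨y₀, hy₀⟩ := h.right_nonempty
    have h2 := h.far x₀ hx₀ y₀ hy₀
    -- Two far sets have at least a + 2 elements in their union. With a, b ≥ 2, the sum (a-1)b +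
    -- a(b-1) is at least ab.
    have hb : 2 ≤ b := by
      have h3 := card_union_add_card_inter x₀ y₀
      have h4 := card_le_card (union_subset (h.left_mem x₀ hx₀).1 (h.right_mem y₀ hy₀).1)
      rw [(h.left_mem x₀ hx₀).2, (h.right_mem y₀ hy₀).2] at h3
      lia
    obtain ⟨a, rfl⟩ : ∃ a', a = a' + 1 := ⟨a - 1, by lia⟩
    obtain ⟨b, rfl⟩ : ∃ b', b = b' + 1 := ⟨b - 1, by lia⟩
    -- A one-member family varies at no element, so its neighbourhood is counted directly instead.
    rcases Nat.lt_or_eq_of_le (card_pos.2 h.left_nonempty) with hA1 | hA1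
    · obtain ⟨e, he, hAin, hAout⟩ := exists_mem_and_exists_notMem h.left_mem hA1
      have hUe := card_erase_add_one he
      rw [← card_memberSubfamily_add_card_nonMemberSubfamily e T]
      by_cases hBin : ∃ x ∈ B, e ∈ x
      · have h1 := ih (h.member he hAin hBin) (a := a) (b := b + 1) (by lia) (by lia)
        by_cases hBout : ∃ x ∈ B, e ∉ x
        · have h0 := ih (h.nonMember hAout hBout) (b := b) (by lia) (by lia)
          nlinarith
        · push Not at hBout
          have h0 := h.card_le_nonMemberSubfamily hBout
          nlinarith [show #U - (a + 1) = b + 1 by lia]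
      · push Not at hBin
        have h0 := ih (h.nonMember hAout (h.right_nonempty.imp fun x hx => ⟨hx, hBin x hx⟩))
          (b := b) (by lia) (by lia)
        have h1 := h.card_le_memberSubfamily he hBin
        nlinarith
    · obtain ⟨x, rfl⟩ := card_eq_one.1 hA1.symm
      have := h.symm.mul_le_card_of_singleton
      rwa [hU, Nat.add_sub_cancel_left] at this

/-! ### Cuts with at least two vertices on both sides -/

/-- A set containing p and q meets a set of the same size avoiding both in at most k - 2 elements,
so z does the opposite of F at p and q. -/
lemma exists_far {W : Finset α} {F : Finset (Finset α)} {p q : α} (hpq : p ≠ q) (hp : p ∈ W)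
    (hq : q ∈ W) (hk : 2 ≤ k) (hkW : k + 2 ≤ #W) (hF : ∀ x ∈ F, #x = k)
    (hconst : (∀ x ∈ F, p ∈ x ∧ q ∈ x) ∨ ∀ x ∈ F, p ∉ x ∧ q ∉ x) :
    ∃ z ⊆ W, #z = k ∧ ∀ x ∈ F, #(x ∩ z) + 2 ≤ k := by
  have hpair : ({p, q} : Finset α) ⊆ W := by
    simp [insert_subset_iff, hp, hq]
  have key : ∀ x y : Finset α, #x = k → p ∈ x → q ∈ x → p ∉ y → q ∉ y → #(x ∩ y) + 2 ≤ k := by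
    intro x y hx h1 h2 h3 h4
    have hd : Disjoint (x ∩ y) {p, q} := by simp [h3, h4]
    rw [← hx, ← card_pair hpq, ← card_union_of_disjoint hd]
    exact card_le_card (union_subset inter_subset_left (by simp [insert_subset_iff, h1, h2]))
  rcases hconst with h | h
  · obtain ⟨z, hz, hzk⟩ := exists_subset_card_eq (s := W \ {p, q}) (n := k)
      (by rw [card_sdiff_of_subset hpair, card_pair hpq]; lia)
    refine ⟨z, hz.trans sdiff_subset, hzk, fun x hx => ?_⟩
    refine key x z (hF x hx) (h x hx).1 (h x hx).2 (fun h' => ?_) (fun h' => ?_)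
    · simpa using hz h'
    · simpa using hz h'
  · obtain ⟨z, hz, hzW, hzk⟩ := exists_subsuperset_card_eq hpair (n := k)
      (by rw [card_pair hpq]; exact hk) (by lia)
    refine ⟨z, hzW, hzk, fun x hx => ?_⟩
    rw [inter_comm]
    exact key z x hzk (hz (by simp)) (hz (by simp)) (h x hx).1 (h x hx).2

/-- The bound for families such that `A` is constant at two elements in the same way, and at some
element `A` varies and `B` is constant. -/
lemma two_mul_mul_le_of_const {a b : ℕ} (h : IsJohnsonSeparation U a A B T) (hU : #U = a + b)
    (ha : 3 ≤ a) (hb : 3 ≤ b) {p q : α} (hpq : p ≠ q) (hp : p ∈ U) (hq : q ∈ U) (he : e ∈ U)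
    (hconst : (∀ x ∈ A, p ∈ x ∧ q ∈ x) ∨ ∀ x ∈ A, p ∉ x ∧ q ∉ x)
    (hAin : ∃ x ∈ A, e ∈ x) (hAout : ∃ x ∈ A, e ∉ x)
    (hB : (∀ x ∈ B, e ∈ x) ∨ ∀ x ∈ B, e ∉ x) :
    2 * (a * b) ≤ #T + a + b := by
  obtain ⟨a, rfl⟩ : ∃ a', a = a' + 1 := ⟨a - 1, by lia⟩
  obtain ⟨b, rfl⟩ : ∃ b', b = b' + 1 := ⟨b - 1, by lia⟩
  obtain ⟨x₁, hx₁, hex₁⟩ := hAin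
  obtain ⟨x₂, hx₂, hex₂⟩ := hAout
  have hUe := card_erase_add_one he
  have hpe : p ≠ e := by
    rintro rfl
    rcases hconst with h' | h'
    · exact hex₂ (h' _ hx₂).1
    · exact (h' _ hx₁).1 hex₁
  have hqe : q ≠ e := by
    rintro rfl
    rcases hconst with h' | h'
    · exact hex₂ (h' _ hx₂).2
    · exact (h' _ hx₁).2 hex₁
  rw [← card_memberSubfamily_add_card_nonMemberSubfamily e T]
  suffices a * (b + 1) ≤ #(T.memberSubfamily e) ∧ (a + 1) * b ≤ #(T.nonMemberSubfamily e) by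
    nlinarith
  rcases hB with hB | hB
  · refine ⟨(h.member he ⟨x₁, hx₁, hex₁⟩ (h.right_nonempty.imp fun x hx => ⟨hx, hB x hx⟩)).mul_le_card
      (by lia), ?_⟩
    -- This slice consists of members of A and T only, and z may lie in T. Room for z outside {p, q}
    -- comes from the original b being at least 3.
    obtain ⟨z, hzW, hzk, hz⟩ := exists_far (k := a + 1) (F := A.nonMemberSubfamily e)
      hpq (mem_erase.2 ⟨hpe, hp⟩) (mem_erase.2 ⟨hqe, hq⟩) (by lia) (by lia)
      (fun x hx => (h.left_mem x (mem_nonMemberSubfamily.1 hx).1).2)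
      (hconst.imp (fun h' x hx => h' x (mem_nonMemberSubfamily.1 hx).1)
        (fun h' x hx => h' x (mem_nonMemberSubfamily.1 hx).1))
    exact (h.nonMember_of_far ⟨x₂, hx₂, hex₂⟩ hB hzW hzk hz).mul_le_card (by lia)
  · refine ⟨?_, (h.nonMember ⟨x₂, hx₂, hex₂⟩
      (h.right_nonempty.imp fun x hx => ⟨hx, hB x hx⟩)).mul_le_card (by lia)⟩
    -- Here z has one element fewer; it can still contain p and q because the original a is at least
    -- 3.
    obtain ⟨z, hzW, hzk, hz⟩ := exists_far (k := a) (F := A.memberSubfamily e)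
      hpq (mem_erase.2 ⟨hpe, hp⟩) (mem_erase.2 ⟨hqe, hq⟩) (by lia) (by lia)
      (fun x hx => (mem_of_mem_memberSubfamily h.left_mem hx).2)
      (hconst.imp
        (fun h' x hx => by simpa [hpe, hqe] using h' _ (mem_memberSubfamily.1 hx).1)
        (fun h' x hx => by simpa [hpe, hqe] using h' _ (mem_memberSubfamily.1 hx).1))
    exact (h.member_of_far he ⟨x₁, hx₁, hex₁⟩ hB hzW hzk hz).mul_le_card (by lia)

/-- Of three elements at which A is constant, two lie both in all members or both in none. -/
lemma two_mul_mul_le_of_three_le {a b : ℕ} (h : IsJohnsonSeparation U a A B T) (hU : #U = a + b)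
    (ha : 3 ≤ a) (hb : 3 ≤ b) (hA : 1 < #A)
    (hsplit : ∀ e ∈ U, ((∀ x ∈ A, e ∈ x) ∨ ∀ x ∈ A, e ∉ x) ∨ (∀ x ∈ B, e ∈ x) ∨ ∀ x ∈ B, e ∉ x)
    (h3 : 3 ≤ #{e ∈ U | (∀ x ∈ A, e ∈ x) ∨ ∀ x ∈ A, e ∉ x}) :
    2 * (a * b) ≤ #T + a + b := by
  obtain ⟨e, he, hin, hout⟩ := exists_mem_and_exists_notMem h.left_mem hA
  have hB : (∀ x ∈ B, e ∈ x) ∨ ∀ x ∈ B, e ∉ x := by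
    refine (hsplit e he).resolve_left ?_
    push Not
    exact ⟨hout, hin⟩
  rw [filter_or] at h3
  have h4 := h3.trans (card_union_le _ _)
  have h5 : 1 < #{e ∈ U | ∀ x ∈ A, e ∈ x} ∨ 1 < #{e ∈ U | ∀ x ∈ A, e ∉ x} := by lia
  rcases h5 with h5 | h5 <;> obtain ⟨p, hp, q, hq, hpq⟩ := one_lt_card.1 h5 <;>
    rw [mem_filter] at hp hq
  · exact h.two_mul_mul_le_of_const hU ha hb hpq hp.1 hq.1 he
      (Or.inl fun x hx => ⟨hp.2 x hx, hq.2 x hx⟩) hin hout hB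
  · exact h.two_mul_mul_le_of_const hU ha hb hpq hp.1 hq.1 he
      (Or.inr fun x hx => ⟨hp.2 x hx, hq.2 x hx⟩) hin hout hB

/-- A cut of the Johnson graph leaving at least two vertices on both sides has at least
`2ab - a - b` vertices. -/
theorem two_mul_mul_le {a b : ℕ} (h : IsJohnsonSeparation U a A B T) (hU : #U = a + b)
    (ha : 3 ≤ a) (hb : 3 ≤ b) (hA : 1 < #A) (hB : 1 < #B) :
    2 * (a * b) ≤ #T + a + b := by
  by_cases hsplit : ∀ e ∈ U,
      ((∀ x ∈ A, e ∈ x) ∨ ∀ x ∈ A, e ∉ x) ∨ (∀ x ∈ B, e ∈ x) ∨ ∀ x ∈ B, e ∉ x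
  · have hUle : #U ≤ #{e ∈ U | (∀ x ∈ A, e ∈ x) ∨ ∀ x ∈ A, e ∉ x} +
        #{e ∈ U | (∀ x ∈ B, e ∈ x) ∨ ∀ x ∈ B, e ∉ x} := by
      refine le_trans (card_le_card ?_) (card_union_le _ _)
      rw [← filter_or]
      exact fun e he => mem_filter.2 ⟨he, hsplit e he⟩
    -- The two counts add up to at least a + b ≥ 6.
    rcases (by lia : 3 ≤ #{e ∈ U | (∀ x ∈ A, e ∈ x) ∨ ∀ x ∈ A, e ∉ x} ∨
        3 ≤ #{e ∈ U | (∀ x ∈ B, e ∈ x) ∨ ∀ x ∈ B, e ∉ x}) with h3 | h3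
    · exact h.two_mul_mul_le_of_three_le hU ha hb hA hsplit h3
    · exact h.symm.two_mul_mul_le_of_three_le hU ha hb hB (fun e he => (hsplit e he).symm) h3
  · push Not at hsplit
    obtain ⟨e, he, ⟨hAout, hAin⟩, hBout, hBin⟩ := hsplit
    obtain ⟨a, rfl⟩ : ∃ a', a = a' + 1 := ⟨a - 1, by lia⟩
    obtain ⟨b, rfl⟩ : ∃ b', b = b' + 1 := ⟨b - 1, by lia⟩
    have hUe := card_erase_add_one he
    rw [← card_memberSubfamily_add_card_nonMemberSubfamily e T]
    have h1 := (h.member he hAin hBin).mul_le_card (b := b + 1) (by lia)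
    have h0 := (h.nonMember hAout hBout).mul_le_card (b := b) (by lia)
    nlinarith

end IsJohnsonSeparation

end Finset
-- The neighbourhood of an edge
namespace Finset

variable {α : Type*} [DecidableEq α]

lemma exists_eq_insert_erase {u w : Finset α} (hc : #w = #u) (h : #(w ∩ u) + 1 = #u) :
    ∃ t ∈ u, ∃ s ∉ u, w = insert s (u.erase t) := by
  have h1 := card_sdiff_add_card_inter u w
  have h2 := card_sdiff_add_card_inter w u
  rw [inter_comm] at h1
  obtain ⟨t, ht⟩ := card_eq_one.1 (show #(u \ w) = 1 by lia)
  obtain ⟨s, hs⟩ := card_eq_one.1 (show #(w \ u) = 1 by lia)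
  have ht' := fun x => congrArg (x ∈ ·) ht
  have hs' := fun x => congrArg (x ∈ ·) hs
  simp only [mem_sdiff, mem_singleton, eq_iff_iff] at ht' hs'
  refine ⟨t, ((ht' t).2 rfl).1, s, ((hs' s).2 rfl).2, ?_⟩
  ext x
  have := ht' x
  have := hs' x
  simp only [mem_insert, mem_erase]
  tauto

/-- The sets adjacent, in the Johnson graph, to one of the adjacent sets `insert p Z` and
`insert q Z`, where `R` is the set of all elements outside of both. -/
def johnsonEdgeNeighbors (Z R : Finset α) (p q : α) : Finset (Finset α) :=
  (Z.image fun t => insert p (insert q (Z.erase t))) ∪ (R.image fun s => insert s Z) ∪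
    ((Z ×ˢ R).image fun c => insert c.2 (insert p (Z.erase c.1))) ∪
    ((Z ×ˢ R).image fun c => insert c.2 (insert q (Z.erase c.1)))

lemma card_johnsonEdgeNeighbors_le (Z R : Finset α) (p q : α) :
    #(johnsonEdgeNeighbors Z R p q) ≤ #Z + #R + 2 * (#Z * #R) := by
  have h1 : #(Z.image fun t => insert p (insert q (Z.erase t))) ≤ #Z := card_image_le
  have h2 : #(R.image fun s => insert s Z) ≤ #R := card_image_le
  have h3 : ∀ r, #((Z ×ˢ R).image fun c => insert c.2 (insert r (Z.erase c.1))) ≤ #Z * #R :=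
    fun r => card_image_le.trans (card_product _ _).le
  have h4 := h3 p
  have h5 := h3 q
  unfold johnsonEdgeNeighbors
  have := card_union_le ((Z.image fun t => insert p (insert q (Z.erase t))) ∪
    (R.image fun s => insert s Z) ∪
    ((Z ×ˢ R).image fun c => insert c.2 (insert p (Z.erase c.1))))
    ((Z ×ˢ R).image fun c => insert c.2 (insert q (Z.erase c.1)))
  have := card_union_le ((Z.image fun t => insert p (insert q (Z.erase t))) ∪
    (R.image fun s => insert s Z)) ((Z ×ˢ R).image fun c => insert c.2 (insert p (Z.erase c.1)))
  have := card_union_le (Z.image fun t => insert p (insert q (Z.erase t)))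
    (R.image fun s => insert s Z)
  lia

lemma johnsonEdgeNeighbors_comm (Z R : Finset α) (p q : α) :
    johnsonEdgeNeighbors Z R p q = johnsonEdgeNeighbors Z R q p := by
  simp only [johnsonEdgeNeighbors, insert_comm p q, union_right_comm]

lemma mem_johnsonEdgeNeighbors {Z R w : Finset α} {p q : α} (hp : p ∉ Z)
    (hR : ∀ s, s ∉ Z → s ≠ p → s ≠ q → s ∈ R) (hc : #w = #Z + 1)
    (h : #(w ∩ insert p Z) + 1 = #w) (hw : w ≠ insert q Z) :
    w ∈ johnsonEdgeNeighbors Z R p q := by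
  have hcp := card_insert_of_notMem hp
  obtain ⟨t, ht, s, hs, rfl⟩ := exists_eq_insert_erase (hc.trans hcp.symm) (by lia)
  simp only [mem_insert, not_or] at ht hs
  simp only [johnsonEdgeNeighbors, mem_union, mem_image, mem_product, Prod.exists]
  rcases eq_or_ne t p with rfl | htp
  · rw [erase_insert hp] at hw ⊢
    have hsq : s ≠ q := by rintro rfl; exact hw rfl
    exact Or.inl (Or.inl (Or.inr ⟨s, hR s hs.2 hs.1 hsq, rfl⟩))
  · have htZ := ht.resolve_left htp
    rw [erase_insert_of_ne htp.symm]
    rcases eq_or_ne s q with rfl | hsq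
    · exact Or.inl (Or.inl (Or.inl ⟨t, htZ, insert_comm _ _ _⟩))
    · exact Or.inl (Or.inr ⟨t, s, ⟨htZ, hR s hs.2 hs.1 hsq⟩, rfl⟩)

/-- Either s adds nothing to the intersection, or the loss of t pays for it. -/
lemma card_insert_erase_inter_le {w u : Finset α} {s t : α} (h : s ∉ u ∨ t ∈ w ∩ u) :
    #(insert s (w.erase t) ∩ u) ≤ #(w ∩ u) := by
  rcases h with h | h
  · rw [insert_inter_of_notMem h]
    exact card_le_card (inter_subset_inter_right (erase_subset _ _))
  · have h1 : insert s (w.erase t) ∩ u ⊆ insert s ((w ∩ u).erase t) := by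
      intro x
      simp only [mem_inter, mem_insert, mem_erase]
      tauto
    have h2 := card_erase_add_one h
    have h3 := card_insert_le s ((w ∩ u).erase t)
    have h4 := card_le_card h1
    lia

/-- A set far from two adjacent sets `insert p Z` and `insert q Z` has a neighbour in the Johnson
graph that is far from both. -/
lemma exists_swap_far [Fintype α] {Z w : Finset α} {p q : α} {k : ℕ} (hp : p ∉ Z)
    (hq : q ∉ Z) (hpq : p ≠ q) (hZ : #Z + 1 = k) (hk : 3 ≤ k) (hn : k + 3 ≤ Fintype.card α)
    (hwk : #w = k) (hwp : #(w ∩ insert p Z) + 2 ≤ k) (hwq : #(w ∩ insert q Z) + 2 ≤ k) :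
    ∃ t ∈ w, ∃ s ∉ w, #(insert s (w.erase t) ∩ insert p Z) + 2 ≤ k ∧
      #(insert s (w.erase t) ∩ insert q Z) + 2 ≤ k := by
  obtain ⟨t₀, ht₀⟩ : w.Nonempty := card_pos.1 (by lia)
  by_cases h1 : ∃ s ∉ w, s ∉ insert p (insert q Z)
  · obtain ⟨s, hsw, hs⟩ := h1
    simp only [mem_insert, not_or] at hs
    refine ⟨t₀, ht₀, s, hsw, ?_, ?_⟩
    · have := card_insert_erase_inter_le (w := w) (u := insert p Z) (s := s) (t := t₀)
        (Or.inl (by simp [hs]))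
      lia
    · have := card_insert_erase_inter_le (w := w) (u := insert q Z) (s := s) (t := t₀)
        (Or.inl (by simp [hs]))
      lia
  by_cases h2 : ∃ t ∈ w, t ∈ Z
  · obtain ⟨t, htw, htZ⟩ := h2
    obtain ⟨s, hs⟩ : ∃ s, s ∉ w := by
      by_contra! h'
      have := card_le_card (fun x _ => h' x : univ ⊆ w)
      rw [card_univ] at this
      lia
    refine ⟨t, htw, s, hs, ?_, ?_⟩
    · have := card_insert_erase_inter_le (w := w) (u := insert p Z) (s := s) (t := t)
        (Or.inr (by simp [htw, htZ]))
      lia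
    · have := card_insert_erase_inter_le (w := w) (u := insert q Z) (s := s) (t := t)
        (Or.inr (by simp [htw, htZ]))
      lia
  -- Now w is disjoint from Z and contains everything outside Z ∪ {p, q}. Swapping in some s from Z
  -- leaves an intersection within {s, r}, where r is p or q. This is enough for k ≥ 4; for k = 3, r
  -- must also be kept out.
  push Not at h1 h2
  obtain ⟨s, hsZ⟩ : Z.Nonempty := card_pos.1 (by lia)
  have hsw : s ∉ w := fun h' => h2 s h' hsZ
  have hcompl : #(insert p (insert q Z))ᶜ + (k + 1) = Fintype.card α := by
    have h3 : #(insert p (insert q Z)) = k + 1 := by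
      rw [card_insert_of_notMem (by simp [hp, hpq]), card_insert_of_notMem hq, hZ]
    rw [← h3, card_compl_add_card]
  -- At least two elements lie outside Z ∪ {p, q}, all in w; with p and q there would be four.
  have hnot : k = 3 → ¬ (p ∈ w ∧ q ∈ w) := by
    rintro rfl ⟨hpw, hqw⟩
    have hsub : {p, q} ∪ (insert p (insert q Z))ᶜ ⊆ w := by
      refine union_subset (by simp [insert_subset_iff, hpw, hqw]) fun x hx => ?_
      by_contra hxw
      exact (mem_compl.1 hx) (h1 x hxw)
    have hd : Disjoint {p, q} (insert p (insert q Z))ᶜ := by simp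
    have := card_le_card hsub
    rw [card_union_of_disjoint hd, card_pair hpq] at this
    lia
  obtain ⟨t, ht, htpq⟩ : ∃ t ∈ w, k = 3 → ∀ x ∈ w, x = p ∨ x = q → x = t := by
    by_cases hpw : p ∈ w
    · exact ⟨p, hpw, fun h3 x hx h => h.elim id fun h' => absurd ⟨hpw, h' ▸ hx⟩ (hnot h3)⟩
    by_cases hqw : q ∈ w
    · exact ⟨q, hqw, fun h3 x hx h => h.elim (fun h' => absurd (h' ▸ hx) hpw) id⟩
    · refine ⟨t₀, ht₀, fun _ x hx h => ?_⟩
      rcases h with rfl | rfl <;> contradiction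
  have key : ∀ r, r = p ∨ r = q → #(insert s (w.erase t) ∩ insert r Z) + 2 ≤ k := by
    intro r hr
    have hsub : insert s (w.erase t) ∩ insert r Z ⊆ {s, r} := by
      intro x
      have := h2 x
      simp only [mem_inter, mem_insert, mem_erase, mem_singleton]
      tauto
    by_cases h3 : k = 3
    · have hsub' : insert s (w.erase t) ∩ insert r Z ⊆ {s} := by
        intro x hx
        have hxs := hsub hx
        simp only [mem_inter, mem_insert, mem_erase, mem_singleton] at hx hxs ⊢
        refine hxs.resolve_right ?_
        rintro rfl
        rcases hx.1 with rfl | hx1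
        · rcases hr with rfl | rfl <;> contradiction
        · exact hx1.1 (htpq h3 x hx1.2 hr)
      have := card_le_card hsub'
      rw [card_singleton] at this
      lia
    · have := (card_le_card hsub).trans card_le_two
      lia
  exact ⟨t, ht, s, hsw, key p (Or.inl rfl), key q (Or.inr rfl)⟩

end Finset

/-! ### The two bounds for super vertex-cuts -/

open Finset

lemma Finset.card_inter_add_two_le {α : Type*} [DecidableEq α] {k : ℕ} {x y : Finset α}
    (hx : #x = k) (hy : #y = k) (hne : x ≠ y) (hadj : #(x ∩ y) + 1 ≠ k) : #(x ∩ y) + 2 ≤ k := by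
  have h1 : #(x ∩ y) ≤ #x := card_le_card inter_subset_left
  have h2 : #(x ∩ y) ≠ k := fun h => hne <| by
    have hxy : x ⊆ y := inter_eq_left.1 (eq_of_subset_of_card_le inter_subset_left (by lia))
    exact eq_of_subset_of_card_le hxy (by lia)
  lia

/-- A super vertex-cut of the Johnson graph has at least `2ab - a - b` vertices. -/
theorem johnsonGraph_le_encard_of_isSuperVertexCut {n k : ℕ} (hk : 3 ≤ k) (hn : k + 3 ≤ n)
    {S : Set {s : Finset (Fin n) // #s = k}} (hS : (johnsonGraph n k).IsSuperVertexCut S) :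
    (((2 * k - 1) * (n - k) - k : ℕ) : ℕ∞) ≤ S.encard := by
  classical
  obtain ⟨hcut, hiso⟩ := hS
  have hnp := hcut.resolve_right (by push Not; exact hiso)
  set H := (johnsonGraph n k).induce Sᶜ with hH
  simp only [SimpleGraph.Preconnected, not_forall] at hnp
  obtain ⟨u, v, huv⟩ := hnp
  have hnbr : ∀ x, ∃ y, H.Adj x y := fun x => by
    simpa [SimpleGraph.IsIsolated] using hiso x
  obtain ⟨u', hu'⟩ := hnbr u
  obtain ⟨v', hv'⟩ := hnbr v
  have hfam : ∀ P : ↥Sᶜ → Prop, ∃ F : Finset (Finset (Fin n)), ∀ s, s ∈ F ↔ ∃ x, P x ∧ x.1.1 = s :=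
    fun P => ⟨univ.filter fun s => ∃ x, P x ∧ x.1.1 = s, fun s => by simp⟩
  have hinj : ∀ x y : ↥Sᶜ, x.1.1 = y.1.1 → x = y := fun x y h => Subtype.ext (Subtype.ext h)
  obtain ⟨A, hA⟩ := hfam fun x => H.Reachable u x
  obtain ⟨B, hB⟩ := hfam fun x => ¬ H.Reachable u x
  let T : Finset (Finset (Fin n)) := S.toFinset.image Subtype.val
  have hsep : IsJohnsonSeparation univ k A B T := by
    refine ⟨fun s hs => ?_, fun s hs => ?_, ⟨u.1.1, (hA _).2 ⟨u, .refl u, rfl⟩⟩,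
      ⟨v.1.1, (hB _).2 ⟨v, huv, rfl⟩⟩, fun s hs t ht => ?_, fun s _ hs => ?_⟩
    · obtain ⟨x, -, rfl⟩ := (hA s).1 hs
      exact ⟨subset_univ _, x.1.2⟩
    · obtain ⟨x, -, rfl⟩ := (hB s).1 hs
      exact ⟨subset_univ _, x.1.2⟩
    · obtain ⟨x, hx, rfl⟩ := (hA s).1 hs
      obtain ⟨y, hy, rfl⟩ := (hB t).1 ht
      refine card_inter_add_two_le x.1.2 y.1.2 (fun h => hy (hinj x y h ▸ hx)) fun h => ?_
      have hadj : H.Adj x y := h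
      exact hy (hx.trans hadj.reachable)
    · by_cases hsS : (⟨s, hs⟩ : {s : Finset (Fin n) // #s = k}) ∈ S
      · exact Or.inr (Or.inr (mem_image.2 ⟨⟨s, hs⟩, by simpa using hsS, rfl⟩))
      · by_cases hr : H.Reachable u ⟨⟨s, hs⟩, hsS⟩
        · exact Or.inl ((hA s).2 ⟨_, hr, rfl⟩)
        · exact Or.inr (Or.inl ((hB s).2 ⟨_, hr, rfl⟩))
  -- Since no vertex of G - S is isolated, u and v each have a neighbour on their own side.
  have hA1 : 1 < #A := one_lt_card.2 ⟨u.1.1, (hA _).2 ⟨u, .refl u, rfl⟩, u'.1.1,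
    (hA _).2 ⟨u', hu'.reachable, rfl⟩, fun h => hu'.ne (hinj _ _ h)⟩
  have hB1 : 1 < #B := one_lt_card.2 ⟨v.1.1, (hB _).2 ⟨v, huv, rfl⟩, v'.1.1,
    (hB _).2 ⟨v', fun h => huv (h.trans hv'.reachable.symm), rfl⟩, fun h => hv'.ne (hinj _ _ h)⟩
  obtain ⟨b, rfl⟩ : ∃ b, n = k + b := ⟨n - k, by lia⟩
  have hmain := hsep.two_mul_mul_le (b := b) (by simp) hk (by lia) hA1 hB1
  have hT : #T ≤ #S.toFinset := card_image_le
  rw [Set.encard_eq_coe_toFinset_card, Nat.cast_le, Nat.add_sub_cancel_left, Nat.sub_mul]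
  have : 2 * k * b = 2 * (k * b) := Nat.mul_assoc _ _ _
  lia

/-- The neighbourhood of an edge of the Johnson graph is a super vertex-cut. -/
theorem exists_isSuperVertexCut_johnsonGraph {n k : ℕ} (hk : 3 ≤ k) (hn : k + 3 ≤ n) :
    ∃ S, (johnsonGraph n k).IsSuperVertexCut S ∧
      S.encard ≤ (((2 * k - 1) * (n - k) - k : ℕ) : ℕ∞) := by
  obtain ⟨Z, -, hZ⟩ := exists_subset_card_eq (s := (univ : Finset (Fin n))) (n := k - 1)
    (by simp; lia)
  have hZc : #Zᶜ = n - (k - 1) := by rw [card_compl, Fintype.card_fin, hZ]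
  obtain ⟨p, hp, q, hq, hpq⟩ := one_lt_card.1 (by lia : 1 < #Zᶜ)
  rw [mem_compl] at hp hq
  have hu : #(insert p Z) = k := by rw [card_insert_of_notMem hp]; lia
  have hv : #(insert q Z) = k := by rw [card_insert_of_notMem hq]; lia
  have hR : #(insert p (insert q Z))ᶜ = n - (k + 1) := by
    rw [card_compl, Fintype.card_fin, card_insert_of_notMem (by simp [hp, hpq]), hv]
  have hmemR : ∀ s, s ∉ Z → s ≠ p → s ≠ q → s ∈ (insert p (insert q Z))ᶜ := fun s h1 h2 h3 => by
    simp [h1, h2, h3]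
  let u : {s : Finset (Fin n) // #s = k} := ⟨insert p Z, hu⟩
  let v : {s : Finset (Fin n) // #s = k} := ⟨insert q Z, hv⟩
  let S : Set {s : Finset (Fin n) // #s = k} :=
    {w | w ≠ u ∧ w ≠ v ∧ ((johnsonGraph n k).Adj w u ∨ (johnsonGraph n k).Adj w v)}
  have hfar : ∀ w : {s : Finset (Fin n) // #s = k}, w ∉ S → w ≠ u → w ≠ v →
      #(w.1 ∩ insert p Z) + 2 ≤ k ∧ #(w.1 ∩ insert q Z) + 2 ≤ k := by
    intro w hw hwu hwv
    have h1 : ¬ ((johnsonGraph n k).Adj w u ∨ (johnsonGraph n k).Adj w v) :=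
      fun h => hw ⟨hwu, hwv, h⟩
    rw [not_or] at h1
    exact ⟨card_inter_add_two_le w.2 hu (fun h => hwu (Subtype.ext h)) h1.1,
      card_inter_add_two_le w.2 hv (fun h => hwv (Subtype.ext h)) h1.2⟩
  have hfar' : ∀ w : {s : Finset (Fin n) // #s = k}, #(w.1 ∩ insert p Z) + 2 ≤ k →
      #(w.1 ∩ insert q Z) + 2 ≤ k → w ∉ S ∧ w ≠ u ∧ w ≠ v := by
    intro w h1 h2
    refine ⟨?_, ?_, ?_⟩
    · rintro ⟨-, -, h | h⟩
      · have h : #(w.1 ∩ insert p Z) + 1 = k := h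
        lia
      · have h : #(w.1 ∩ insert q Z) + 1 = k := h
        lia
    · rintro rfl
      simp only [u, inter_self] at h1
      lia
    · rintro rfl
      simp only [v, inter_self] at h2
      lia
  have huS : u ∉ S := fun h => h.1 rfl
  have hvS : v ∉ S := fun h => h.2.1 rfl
  have huv : (johnsonGraph n k).Adj u v := by
    change #(insert p Z ∩ insert q Z) + 1 = k
    have : insert p Z ∩ insert q Z = Z := by
      ext x
      simp only [mem_inter, mem_insert]
      constructor
      · rintro ⟨rfl | h, h' | h'⟩ <;> first | assumption | exact absurd h' hpq
      · exact fun h => ⟨Or.inr h, Or.inr h⟩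
    rw [this]
    lia
  refine ⟨S, ⟨Or.inl ?_, ?_⟩, ?_⟩
  -- A vertex z containing two elements outside both ends of the edge is far from both ends; it
  -- survives and is cut off from them.
  · obtain ⟨r, hr, r', hr', hrr⟩ := one_lt_card.1 (by lia : 1 < #(insert p (insert q Z))ᶜ)
    simp only [mem_compl, mem_insert, not_or] at hr hr'
    obtain ⟨z, hz, -, hzk⟩ := exists_subsuperset_card_eq (subset_univ {r, r'}) (n := k)
      (by rw [card_pair hrr]; lia) (by simp; lia)
    have hzfar : ∀ y : Finset (Fin n), r ∉ y → r' ∉ y → #(z ∩ y) + 2 ≤ k := by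
      intro y h1 h2
      have hd : Disjoint (z ∩ y) {r, r'} := by simp [h1, h2]
      rw [← hzk, ← card_pair hrr, ← card_union_of_disjoint hd]
      exact card_le_card (union_subset inter_subset_left hz)
    obtain ⟨hzS, hzu, hzv⟩ := hfar' ⟨z, hzk⟩ (hzfar _ (by simp [hr]) (by simp [hr']))
      (hzfar _ (by simp [hr]) (by simp [hr']))
    intro hconn
    have hreach : ∀ x, ((johnsonGraph n k).induce Sᶜ).Reachable ⟨u, huS⟩ x → x.1 = u ∨ x.1 = v := by
      intro x hx
      rw [SimpleGraph.reachable_iff_reflTransGen] at hx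
      induction hx with
      | refl => exact Or.inl rfl
      | @tail y x _ hadj ih =>
        by_contra hne
        rw [not_or] at hne
        have hadj : (johnsonGraph n k).Adj y.1 x.1 := hadj
        refine x.2 ⟨hne.1, hne.2, ?_⟩
        rcases ih with h | h <;> rw [h] at hadj
        · exact Or.inl hadj.symm
        · exact Or.inr hadj.symm
    exact (hreach ⟨⟨z, hzk⟩, hzS⟩ (hconn _ _)).elim hzu hzv
  · rintro ⟨w, hwS⟩ hiso
    have hiso' : ∀ y, y ∉ S → ¬ (johnsonGraph n k).Adj w y := fun y hy => hiso ⟨y, hy⟩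
    by_cases hwu : w = u
    · exact hiso' v hvS (hwu ▸ huv)
    by_cases hwv : w = v
    · exact hiso' u huS (hwv ▸ huv.symm)
    obtain ⟨h1, h2⟩ := hfar w hwS hwu hwv
    obtain ⟨t, ht, s, hs, h3, h4⟩ := exists_swap_far hp hq hpq (by lia) hk (by simpa using hn)
      w.2 h1 h2
    have hc := card_erase_add_one ht
    have hst : s ∉ w.1.erase t := fun h => hs (mem_of_mem_erase h)
    have hw' : #(insert s (w.1.erase t)) = k := by
      rw [card_insert_of_notMem hst, hc, w.2]
    refine hiso' ⟨_, hw'⟩ (hfar' ⟨_, hw'⟩ h3 h4).1 ?_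
    change #(w.1 ∩ insert s (w.1.erase t)) + 1 = k
    rw [inter_insert_of_notMem hs, inter_eq_right.2 (erase_subset _ _), hc, w.2]
  · have hsub : Subtype.val '' S ⊆
        (johnsonEdgeNeighbors Z (insert p (insert q Z))ᶜ p q : Set (Finset (Fin n))) := by
      rintro _ ⟨w, ⟨hwu, hwv, h | h⟩, rfl⟩
      · exact mem_johnsonEdgeNeighbors hp hmemR (by rw [w.2]; lia) (by rw [w.2]; exact h)
          fun h' => hwv (Subtype.ext h')
      · rw [johnsonEdgeNeighbors_comm]
        exact mem_johnsonEdgeNeighbors hq (fun s h1 h2 h3 => hmemR s h1 h3 h2)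
          (by rw [w.2]; lia) (by rw [w.2]; exact h) fun h' => hwu (Subtype.ext h')
    rw [← Subtype.val_injective.encard_image S]
    refine (Set.encard_le_encard hsub).trans ?_
    rw [Set.encard_coe_eq_coe_finsetCard, Nat.cast_le]
    refine (card_johnsonEdgeNeighbors_le _ _ _ _).trans ?_
    rw [hZ, hR]
    obtain ⟨a, rfl⟩ : ∃ a, k = a + 1 := ⟨k - 1, by omega⟩
    obtain ⟨b, rfl⟩ : ∃ b, n = a + 1 + (b + 1) := ⟨n - a - 2, by omega⟩
    rw [show a + 1 + (b + 1) - (a + 1 + 1) = b by omega, show a + 1 + (b + 1) - (a + 1) = b + 1 by omega,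
      show 2 * (a + 1) - 1 = 2 * a + 1 by omega, Nat.add_sub_cancel]
    refine Nat.le_sub_of_add_le (le_of_eq ?_)
    ring

theorem theorem10 (n k : ℕ) (hk : 3 ≤ k) (hn : k + 3 ≤ n) :
    (johnsonGraph n k).superConnectivity = (((2 * k - 1) * (n - k) - k : ℕ) : ℕ∞) := by
  refine le_antisymm ?_ (le_iInf₂ fun S hS => johnsonGraph_le_encard_of_isSuperVertexCut hk hn hS)
  obtain ⟨S, hS, hcard⟩ := exists_isSuperVertexCut_johnsonGraph hk hn
  exact (iInf₂_le S hS).trans hcard
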